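/- Let $\mathbb{D}=\{z\in\mathbb{C}:|z|<1\}$, and let $f$ be a conformal (holomorphic and injective) map of $\mathbb{D}$ onto a bounded convex domain $\Omega\subset\mathbb{C}$, normalized by $f(0)=0$ and $f'(0)=1$. Let $a_2=f''(0)/2$ be its second Taylor coefficient. Then $1+a_2f(z)\neq 0$ for all $z\in\mathbb{D}$, so that the function $$f^{*}(z)=\frac{f(z)}{1+a_2f(z)}$$ is well defined on $\mathbb{D}$, and there is a constant $c<1$ (depending on $f$) such that $$|a_2f^{*}(z)|\leq c\qquad\text{for all } z\in\mathbb{D}.$$ -/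

import Mathlib

/-- The open unit disk in the complex plane. -/
def unitDisk : Set ℂ := Metric.ball (0 : ℂ) 1

/-- `f` is a conformal map of the unit disk onto `Ω` (holomorphic, injective, with image `Ω`),
normalized by `f 0 = 0` and `f' 0 = 1`. Values of `f` outside the disk are irrelevant. -/
structure IsNormalizedConformalMap (f : ℂ → ℂ) (Ω : Set ℂ) : Prop where
  differentiableOn : DifferentiableOn ℂ f unitDisk
  injOn : Set.InjOn f unitDisk
  image_eq : f '' unitDisk = Ω
  map_zero : f 0 = 0
  deriv_zero : deriv f 0 = 1

/-- The second Taylor coefficient of `f` at the origin. -/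
noncomputable def secondCoeff (f : ℂ → ℂ) : ℂ := iteratedDeriv 2 f 0 / 2

/-- The Möbius normalization `f* = f / (1 + a₂ f)`. -/
noncomputable def moebiusNormalization (f : ℂ → ℂ) (z : ℂ) : ℂ :=
  f z / (1 + secondCoeff f * f z)

open Filter Topology ComplexConjugate

/-! Write a = a₂. Since |1 + a f|² - |a f|² = 1 + 2 Re(a f) and f is bounded, everything reduces to
a uniform bound 1 + 2 Re(a f) ≥ δ > 0. By compactness it suffices to prove 1 + 2 Re(a w) > 0 at a
boundary point w of Ω minimizing Re(a w).

Convexity gives the two-point inequality (`two_point`), which passes to the limit at w: for some |ζ|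
= 1, the function p = 2z f'/(f - w) - (z + ζ)/(z - ζ) has nonnegative real part. With p = 1 + 2zT,
its Cayley transform (p - 1)/(p + 1) is zB with |B| ≤ 1. Here B(0) = 1/ζ - 1/w and B'(0) involves a,
so Schwarz-Pick at 0 is exactly 1 + 2 Re(a w) ≥ 0.

If strictness failed, equality in Schwarz-Pick would make B a disk automorphism or a unimodular
constant (`schwarzPick_eq`). Then zB(z) = 1 at some unimodular η ≠ ζ (`exists_radial_pole`), so
f'/(f - w) has a radial pole at η whose sign forces |f - w| to blow up
(`not_bounded_of_tendsto_logDeriv`), contradicting boundedness. -/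

/-! ### Injective holomorphic maps and their inverses -/

theorem Set.InjOn.isOpen_image_of_differentiableOn {f : ℂ → ℂ} {U s : Set ℂ}
    (hinj : Set.InjOn f U) (hf : DifferentiableOn ℂ f U) (hU : IsOpen U)
    (hs : s ⊆ U) (hso : IsOpen s) : IsOpen (f '' s) := by
  rw [isOpen_iff_mem_nhds]
  rintro _ ⟨z, hz, rfl⟩
  have han : AnalyticAt ℂ f z := hf.analyticAt (hU.mem_nhds (hs hz))
  rcases han.eventually_constant_or_nhds_le_map_nhds with h | h
  · exfalso
    have h1 : ∀ᶠ x in 𝓝[≠] z, f x = f z ∧ x ∈ U ∧ x ≠ z :=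
      ((h.filter_mono nhdsWithin_le_nhds).and
        (((hU.eventually_mem (hs hz)).filter_mono nhdsWithin_le_nhds).and self_mem_nhdsWithin))
    obtain ⟨x, hx, hxU, hne⟩ := h1.exists
    exact hne (hinj hxU (hs hz) hx)
  · exact h (image_mem_map (hso.mem_nhds hz))

/-- The inverse is continuous by the open mapping property. It is holomorphic where f' ≠ 0, and
zeros of f' are isolated, so the remaining points are removable singularities. That f' never
vanishes is only a consequence, by the chain rule. -/
theorem Set.InjOn.exists_differentiableOn_leftInverse {f : ℂ → ℂ} {U : Set ℂ}
    (hinj : Set.InjOn f U) (hf : DifferentiableOn ℂ f U) (hU : IsOpen U) :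
    ∃ g : ℂ → ℂ, DifferentiableOn ℂ g (f '' U) ∧ ∀ z ∈ U, g (f z) = z := by
  refine ⟨Function.invFunOn f U, ?_, fun z hz => hinj.leftInvOn_invFunOn hz⟩
  set g := Function.invFunOn f U
  have hg : ∀ z ∈ U, g (f z) = z := fun z hz => hinj.leftInvOn_invFunOn hz
  have hopen : IsOpen (f '' U) :=
    hinj.isOpen_image_of_differentiableOn hf hU subset_rfl hU
  have hcont : ∀ z ∈ U, ContinuousAt g (f z) := by
    intro z hz
    rw [ContinuousAt, hg z hz]
    intro V hV
    obtain ⟨t, htV, hto, hzt⟩ := mem_nhds_iff.1 hV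
    have h1 : f '' (U ∩ t) ∈ 𝓝 (f z) :=
      (hinj.isOpen_image_of_differentiableOn hf hU Set.inter_subset_left
        (hU.inter hto)).mem_nhds ⟨z, ⟨hz, hzt⟩, rfl⟩
    refine mem_map.2 (mem_of_superset h1 ?_)
    rintro _ ⟨x, ⟨hx, hxt⟩, rfl⟩
    rw [Set.mem_preimage, hg x hx]
    exact htV hxt
  have hright : ∀ w ∈ f '' U, f (g w) = w := by
    rintro _ ⟨x, hx, rfl⟩
    rw [hg x hx]
  rintro _ ⟨z, hz, rfl⟩
  refine (DifferentiableAt.differentiableWithinAt ?_)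
  have hd : AnalyticAt ℂ (deriv f) z := (hf.analyticAt (hU.mem_nhds hz)).deriv
  have hne : ∀ᶠ x in 𝓝[≠] z, deriv f x ≠ 0 := by
    refine hd.eventually_eq_zero_or_eventually_ne_zero.resolve_left fun h0 => ?_
    obtain ⟨r, hr, hball⟩ := Metric.eventually_nhds_iff_ball.1 (h0.and (hU.eventually_mem hz))
    have hconst : ∀ x ∈ Metric.ball z r, f x = f z := fun x hx =>
      (convex_ball z r).is_const_of_fderivWithin_eq_zero (𝕜 := ℂ) (f := f)
        (hf.mono fun y hy => (hball y hy).2) (fun y hy => by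
          rw [fderivWithin_of_isOpen Metric.isOpen_ball hy]
          ext
          simpa using (hball y hy).1) hx (Metric.mem_ball_self hr)
    have h1 : ∀ᶠ x in 𝓝[≠] z, x ∈ Metric.ball z r ∧ x ≠ z :=
      ((Metric.isOpen_ball.eventually_mem (Metric.mem_ball_self hr)).filter_mono nhdsWithin_le_nhds).and self_mem_nhdsWithin
    obtain ⟨x, hx, hxz⟩ := h1.exists
    exact hxz (hinj (hball x hx).2 hz (hconst x hx))
  refine (Complex.analyticAt_of_differentiable_on_punctured_nhds_of_continuousAt
    ?_ (hcont z hz)).differentiableAt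
  have htend : Tendsto g (𝓝[≠] (f z)) (𝓝[≠] z) := by
    refine tendsto_nhdsWithin_iff.2 ⟨?_, ?_⟩
    · have := hcont z hz
      rw [ContinuousAt, hg z hz] at this
      exact this.mono_left nhdsWithin_le_nhds
    · filter_upwards [self_mem_nhdsWithin,
        (hopen.eventually_mem (Set.mem_image_of_mem f hz)).filter_mono nhdsWithin_le_nhds] with w hw hwU h
      exact hw (by rw [← hright w hwU, h]; rfl)
  filter_upwards [htend.eventually hne,
    (hopen.eventually_mem (Set.mem_image_of_mem f hz)).filter_mono nhdsWithin_le_nhds] with w hw hwU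
  have hwg : g w ∈ U := by
    obtain ⟨x, hx, rfl⟩ := hwU
    rwa [hg x hx]
  refine (HasDerivAt.of_local_left_inverse (f := f) (f' := deriv f (g w)) ?_ ?_ hw ?_).differentiableAt
  · have := hcont (g w) hwg
    rwa [hright w hwU] at this
  · exact (hf.differentiableAt (hU.mem_nhds hwg)).hasDerivAt
  · filter_upwards [hopen.mem_nhds hwU] with v hv using hright v hv

theorem Set.InjOn.deriv_ne_zero {f : ℂ → ℂ} {U : Set ℂ}
    (hinj : Set.InjOn f U) (hf : DifferentiableOn ℂ f U) (hU : IsOpen U) {z : ℂ} (hz : z ∈ U) :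
    deriv f z ≠ 0 := by
  obtain ⟨g, hg, hgf⟩ := hinj.exists_differentiableOn_leftInverse hf hU
  have hopen : IsOpen (f '' U) :=
    hinj.isOpen_image_of_differentiableOn hf hU subset_rfl hU
  have h1 := (hg.differentiableAt (hopen.mem_nhds ⟨z, hz, rfl⟩)).hasDerivAt.comp z
    (hf.differentiableAt (hU.mem_nhds hz)).hasDerivAt
  have h2 : HasDerivAt (g ∘ f) 1 z := (hasDerivAt_id z).congr_of_eventuallyEq (by
    filter_upwards [hU.mem_nhds hz] with x hx using hgf x hx)
  intro h0
  have := h1.unique h2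
  simp [h0] at this

/-! ### Convexity and the two-point inequality -/

theorem isOpen_unitDisk : IsOpen unitDisk := Metric.isOpen_ball

theorem mem_unitDisk {z : ℂ} : z ∈ unitDisk ↔ ‖z‖ < 1 := mem_ball_zero_iff

/-- Convexity keeps (1 - t) f(x) + t f((ζ/z) x) in Ω, so composing with g gives a self-map of the
disk fixing 0. The Schwarz lemma at x = z is the claim. -/
theorem IsNormalizedConformalMap.norm_preimage_segment_le {f g : ℂ → ℂ} {Ω : Set ℂ}
    (hf : IsNormalizedConformalMap f Ω) (hconv : Convex ℝ Ω) (hg : DifferentiableOn ℂ g Ω)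
    (hgf : ∀ z ∈ unitDisk, g (f z) = z) {z ζ : ℂ} (hz : z ∈ unitDisk) (hz0 : z ≠ 0)
    (hζ : ‖ζ‖ ≤ ‖z‖) {t : ℝ} (ht0 : 0 ≤ t) (ht1 : t ≤ 1) :
    ‖g (f z + t * (f ζ - f z))‖ ≤ ‖z‖ := by
  have hq : ‖ζ / z‖ ≤ 1 := by
    rw [norm_div]; exact div_le_one_of_le₀ hζ (norm_nonneg _)
  have hmul : ∀ x ∈ unitDisk, ζ / z * x ∈ unitDisk := by
    intro x hx
    rw [mem_unitDisk] at hx ⊢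
    rw [norm_mul]
    nlinarith [norm_nonneg x, norm_nonneg (ζ / z)]
  have hmemΩ : ∀ x ∈ unitDisk, f x ∈ Ω := fun x hx => hf.image_eq ▸ Set.mem_image_of_mem f hx
  have hseg : ∀ x ∈ unitDisk, f x + t * (f (ζ / z * x) - f x) ∈ Ω := by
    intro x hx
    have := hconv (hmemΩ x hx) (hmemΩ _ (hmul x hx)) (sub_nonneg.2 ht1) ht0 (by ring)
    convert this using 1
    simp only [Complex.real_smul]
    push_cast
    ring
  have hmaps : ∀ w ∈ Ω, g w ∈ unitDisk := by
    intro w hw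
    rw [← hf.image_eq] at hw
    obtain ⟨x, hx, rfl⟩ := hw
    rwa [hgf x hx]
  have hdiff : DifferentiableOn ℂ (fun x => g (f x + t * (f (ζ / z * x) - f x))) unitDisk := by
    refine hg.comp (t := Ω) (hf.differentiableOn.add (DifferentiableOn.const_mul
      (DifferentiableOn.sub (hf.differentiableOn.comp (t := unitDisk) ?_ hmul)
        hf.differentiableOn) _)) hseg
    fun_prop
  have hS := Complex.norm_le_norm_of_mapsTo_ball (R := 1) (z := z) hdiff
    (fun x hx => Metric.ball_subset_closedBall (hmaps _ (hseg x hx)))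
    (by
      have h0 : (0 : ℂ) ∈ unitDisk := by simp [mem_unitDisk]
      have := hgf 0 h0
      rw [hf.map_zero] at this
      simp [hf.map_zero, this])
    (mem_unitDisk.1 hz)
  rwa [div_mul_cancel₀ _ hz0] at hS

/-- The image of every disk centred at the origin is convex, in infinitesimal form. -/
theorem IsNormalizedConformalMap.re_div_nonneg {f : ℂ → ℂ} {Ω : Set ℂ}
    (hf : IsNormalizedConformalMap f Ω) (hconv : Convex ℝ Ω) {z ζ : ℂ} (hz : z ∈ unitDisk)
    (hζ : ‖ζ‖ ≤ ‖z‖) : 0 ≤ ((f z - f ζ) / (z * deriv f z)).re := by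
  rcases eq_or_ne z 0 with rfl | hz0
  · simp
  obtain ⟨g, hg, hgf⟩ := hf.injOn.exists_differentiableOn_leftInverse hf.differentiableOn
    isOpen_unitDisk
  rw [hf.image_eq] at hg
  have hopen : IsOpen Ω := hf.image_eq ▸
    hf.injOn.isOpen_image_of_differentiableOn hf.differentiableOn isOpen_unitDisk subset_rfl
      isOpen_unitDisk
  have hfz : f z ∈ Ω := hf.image_eq ▸ Set.mem_image_of_mem f hz
  have hgd := (hg.differentiableAt (hopen.mem_nhds hfz)).hasDerivAt
  have hd0 := hf.injOn.deriv_ne_zero hf.differentiableOn isOpen_unitDisk hz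
  have hgd' : deriv g (f z) = (deriv f z)⁻¹ := by
    have h1 := hgd.comp z (hf.differentiableOn.differentiableAt
      (isOpen_unitDisk.mem_nhds hz)).hasDerivAt
    have h2 : HasDerivAt (g ∘ f) 1 z := (hasDerivAt_id z).congr_of_eventuallyEq (by
      filter_upwards [isOpen_unitDisk.mem_nhds hz] with x hx using hgf x hx)
    exact eq_inv_of_mul_eq_one_left (h1.unique h2)
  rw [hgd'] at hgd
  set v := f ζ - f z with hv
  have hγ : HasDerivAt (fun t : ℝ => g (f z + t * v)) ((deriv f z)⁻¹ * v) 0 := by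
    have hline : HasDerivAt (fun t : ℝ => f z + t * v) v 0 := by
      simpa using ((Complex.ofRealCLM.hasDerivAt (x := (0 : ℝ))).mul_const v).const_add (f z)
    have hgd2 : HasDerivAt g (deriv f z)⁻¹ ((fun t : ℝ => f z + t * v) 0) := by simpa using hgd
    exact hgd2.comp (0 : ℝ) hline
  have hre : HasDerivAt (fun t : ℝ => (g (f z + t * v) / z).re)
      (((deriv f z)⁻¹ * v) / z).re 0 := by
    have := Complex.reCLM.hasFDerivAt.comp_hasDerivAt (0 : ℝ) (hγ.div_const z)
    simpa using! this
  -- The real part of g(f z + t v)/z equals 1 at t = 0 and is at most 1 for 0 ≤ t ≤ 1, so its right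
  -- derivative at 0 is nonpositive.
  have hle : (((deriv f z)⁻¹ * v) / z).re ≤ 0 := by
    have h1 := hasDerivWithinAt_iff_tendsto_slope' (s := Set.Ioi (0 : ℝ)) (by simp) |>.1
      hre.hasDerivWithinAt
    refine le_of_tendsto h1 ?_
    filter_upwards [self_mem_nhdsWithin,
      mem_nhdsWithin_of_mem_nhds (Iic_mem_nhds (zero_lt_one' ℝ))] with t ht0 ht1
    have ht0' : 0 < t := ht0
    have hb := hf.norm_preimage_segment_le hconv hg hgf hz hz0 hζ ht0'.le ht1
    have hb2 : (g (f z + t * v) / z).re ≤ 1 :=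
      (Complex.re_le_norm _).trans (by
        rw [norm_div]; exact div_le_one_of_le₀ hb (norm_nonneg _))
    rw [slope_def_field]
    refine div_nonpos_of_nonpos_of_nonneg ?_ (by linarith)
    simpa [hgf z hz, hz0] using hb2
  have : (f z - f ζ) / (z * deriv f z) = -(((deriv f z)⁻¹ * v) / z) := by
    rw [hv]; field_simp; ring
  rw [this, Complex.neg_re]
  linarith

theorem Complex.inv_re_nonneg {x : ℂ} (hx : 0 ≤ x.re) : 0 ≤ (x⁻¹).re := by
  rw [Complex.inv_re]
  exact div_nonneg hx (Complex.normSq_nonneg _)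

theorem Complex.re_add_div_sub_eq_zero {z ζ : ℂ} (h : ‖z‖ = ‖ζ‖) : ((z + ζ) / (z - ζ)).re = 0 := by
  have h2 : z.re * z.re + z.im * z.im = ζ.re * ζ.re + ζ.im * ζ.im := by
    rw [← Complex.normSq_apply, ← Complex.normSq_apply, Complex.normSq_eq_norm_sq,
      Complex.normSq_eq_norm_sq, h]
  rw [Complex.div_re, ← add_div, Complex.add_re, Complex.add_im, Complex.sub_re, Complex.sub_im]
  rw [div_eq_zero_iff]
  left
  linarith

/-- Maximum modulus for exp(-p), whose modulus is exp(-Re p). -/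
theorem Complex.re_nonneg_of_re_nonneg_on_sphere {p : ℂ → ℂ} {r : ℝ}
    (hp : DiffContOnCl ℂ p (Metric.ball 0 r)) (h : ∀ z, ‖z‖ = r → 0 ≤ (p z).re) {z : ℂ}
    (hz : ‖z‖ < r) : 0 ≤ (p z).re := by
  have hr : r ≠ 0 := ((norm_nonneg z).trans_lt hz).ne'
  have hE : DiffContOnCl ℂ (fun z => Complex.exp (-p z)) (Metric.ball 0 r) :=
    Complex.differentiable_exp.comp_diffContOnCl hp.neg
  have := Complex.norm_le_of_forall_mem_frontier_norm_le (C := 1) Metric.isBounded_ball hE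
    (fun x hx => by
      rw [frontier_ball _ hr, mem_sphere_zero_iff_norm] at hx
      rw [Complex.norm_exp, Real.exp_le_one_iff, Complex.neg_re]
      linarith [h x hx])
    (subset_closure (mem_ball_zero_iff.2 hz))
  rw [Complex.norm_exp, Real.exp_le_one_iff, Complex.neg_re] at this
  linarith

/-- The two-point inequality for convex univalent functions. -/
theorem IsNormalizedConformalMap.two_point {f : ℂ → ℂ} {Ω : Set ℂ}
    (hf : IsNormalizedConformalMap f Ω) (hconv : Convex ℝ Ω) {z ζ : ℂ} (hζ : ζ ∈ unitDisk)
    (hzζ : ‖z‖ < ‖ζ‖) :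
    0 ≤ (2 * z * deriv f z / (f z - f ζ) - (z + ζ) / (z - ζ)).re := by
  have hD := isOpen_unitDisk.mem_nhds hζ
  have hζ0 : ζ ≠ 0 := by
    rintro rfl
    simp only [norm_zero] at hzζ
    exact absurd hzζ (norm_nonneg z).not_gt
  set k := dslope f ζ with hk
  have hkd : DifferentiableOn ℂ k unitDisk :=
    (Complex.differentiableOn_dslope hD).2 hf.differentiableOn
  have hk0 : ∀ x ∈ unitDisk, k x ≠ 0 := by
    intro x hx
    rcases eq_or_ne x ζ with rfl | hne
    · rw [hk, dslope_same]
      exact hf.injOn.deriv_ne_zero hf.differentiableOn isOpen_unitDisk hx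
    · rw [hk, dslope_of_ne _ hne, slope_def_field]
      exact div_ne_zero (sub_ne_zero.2 fun h => hne (hf.injOn hx hζ h)) (sub_ne_zero.2 hne)
  -- The two poles at ζ cancel: over the common denominator (x - ζ) k(x) the numerator N vanishes at
  -- ζ, so `dslope` supplies the holomorphic extension.
  set N : ℂ → ℂ := fun x => 2 * x * deriv f x - (x + ζ) * k x with hN
  have hNd : DifferentiableOn ℂ N unitDisk := by
    have := hf.differentiableOn.deriv isOpen_unitDisk
    fun_prop
  have hNζ : N ζ = 0 := by simp only [hN, hk, dslope_same]; ring
  set p : ℂ → ℂ := fun x => dslope N ζ x / k x with hp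
  have hpd : DifferentiableOn ℂ p unitDisk :=
    ((Complex.differentiableOn_dslope hD).2 hNd).div hkd hk0
  have hpeq : ∀ x ∈ unitDisk, x ≠ ζ →
      p x = 2 * x * deriv f x / (f x - f ζ) - (x + ζ) / (x - ζ) := by
    intro x hx hne
    have h1 : x - ζ ≠ 0 := sub_ne_zero.2 hne
    have h2 : f x - f ζ ≠ 0 := sub_ne_zero.2 fun h => hne (hf.injOn hx hζ h)
    simp only [hp, dslope_of_ne _ hne, slope_def_field, hNζ]
    simp only [hN, hk, dslope_of_ne _ hne, slope_def_field]
    field_simp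
    ring
  -- On this circle (x + ζ)/(x - ζ) is purely imaginary, so only the term controlled by convexity
  -- remains.
  have hcirc : ∀ x, ‖x‖ = ‖ζ‖ → x ≠ ζ → 0 ≤ (p x).re := by
    intro x hx hne
    have hxD : x ∈ unitDisk := by rw [mem_unitDisk, hx]; exact mem_unitDisk.1 hζ
    rw [hpeq x hxD hne, Complex.sub_re, Complex.re_add_div_sub_eq_zero hx, sub_zero]
    have h3 := Complex.inv_re_nonneg (hf.re_div_nonneg hconv hxD hx.ge)
    have : 2 * x * deriv f x / (f x - f ζ) =
        ((2 : ℝ) : ℂ) * ((f x - f ζ) / (x * deriv f x))⁻¹ := by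
      rw [inv_div]; push_cast; ring
    rw [this, Complex.re_ofReal_mul]
    positivity
  have hzD : z ∈ unitDisk := mem_unitDisk.2 (hzζ.trans (mem_unitDisk.1 hζ))
  have hne : z ≠ ζ := by rintro rfl; exact lt_irrefl _ hzζ
  rw [← hpeq z hzD hne]
  refine Complex.re_nonneg_of_re_nonneg_on_sphere (r := ‖ζ‖) ?_ ?_ hzζ
  · refine DifferentiableOn.diffContOnCl (hpd.mono fun x hx => ?_)
    rw [closure_ball _ (norm_ne_zero_iff.2 hζ0), mem_closedBall_zero_iff] at hx
    exact mem_unitDisk.2 (hx.trans_lt (mem_unitDisk.1 hζ))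
  · intro x hx
    rcases eq_or_ne x ζ with rfl | hxne
    · have hcont : ContinuousAt p x := (hpd.differentiableAt hD).continuousAt
      -- The exceptional point ζ is reached by continuity along the circle.
      have hpath : Tendsto (fun t : ℝ => x * Complex.exp (t * Complex.I)) (𝓝[>] 0) (𝓝 x) := by
        have : Continuous fun t : ℝ => x * Complex.exp (t * Complex.I) := by fun_prop
        have h0 := this.tendsto 0
        simp only [Complex.ofReal_zero, zero_mul, Complex.exp_zero, mul_one] at h0
        exact h0.mono_left nhdsWithin_le_nhds
      refine ge_of_tendsto ((Complex.continuous_re.tendsto _).comp (hcont.tendsto.comp hpath)) ?_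
      filter_upwards [Ioo_mem_nhdsGT (zero_lt_one' ℝ)] with t ht
      refine hcirc _ (by simp [Complex.norm_exp_ofReal_mul_I]) fun h => ?_
      have h1 : Complex.exp (t * Complex.I) = 1 := by
        simpa [hζ0] using h
      have h2 : Real.sin t = 0 := by
        rw [← Complex.exp_ofReal_mul_I_im, h1, Complex.one_im]
      exact (Real.sin_pos_of_pos_of_lt_pi ht.1 (by linarith [ht.2, Real.pi_gt_three])).ne' h2
    · exact hcirc x hx hxne

/-! ### Schwarz-Pick rigidity -/

/-- The equality case of the Schwarz-Pick inequality at the origin. -/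
theorem Complex.schwarzPick_eq {B : ℂ → ℂ} (hB : DifferentiableOn ℂ B unitDisk)
    (hB1 : ∀ z ∈ unitDisk, ‖B z‖ ≤ 1) (hd : 1 - ‖B 0‖ ^ 2 ≤ ‖deriv B 0‖) :
    ∃ u : ℂ, ‖u‖ = 1 ∧ ∀ z ∈ unitDisk, B z * (1 + conj (B 0) * u * z) = B 0 + u * z := by
  have h0 : (0 : ℂ) ∈ unitDisk := by simp [mem_unitDisk]
  set s := B 0 with hs
  have hss : conj s * s = (‖s‖ ^ 2 : ℝ) := by
    rw [mul_comm, Complex.mul_conj, Complex.normSq_eq_norm_sq]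
  rcases (hB1 0 h0).lt_or_eq with hlt | heq
  · rw [← hs] at hlt
    have hden : ∀ z ∈ unitDisk, 1 - conj s * B z ≠ 0 := by
      intro z hz h
      have h1 : ‖conj s * B z‖ = 1 := by rw [← sub_eq_zero.1 h, norm_one]
      rw [norm_mul, RCLike.norm_conj] at h1
      nlinarith [hB1 z hz, norm_nonneg s, norm_nonneg (B z)]
    -- Moving s to 0 by a disk automorphism reduces the claim to the equality case of the Schwarz
    -- lemma, where ψ is a rotation by u = ψ'(0).
    set ψ : ℂ → ℂ := fun z => (B z - s) / (1 - conj s * B z) with hψ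
    have hψd : DifferentiableOn ℂ ψ unitDisk := by
      refine DifferentiableOn.div (by fun_prop) (by fun_prop) hden
    have hψ0 : ψ 0 = 0 := by simp [hψ, hs]
    have hψ1 : Set.MapsTo ψ (Metric.ball 0 1) (Metric.closedBall (ψ 0) 1) := by
      intro z hz
      rw [hψ0, mem_closedBall_zero_iff]
      simp only [hψ]
      rw [norm_div]
      refine div_le_one_of_le₀ ?_ (norm_nonneg _)
      refine (sq_le_sq₀ (norm_nonneg _) (norm_nonneg _)).1 ?_
      have hb : ‖B z‖ ^ 2 ≤ 1 := pow_le_one₀ (norm_nonneg _) (hB1 z hz)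
      have ha : ‖s‖ ^ 2 ≤ 1 := pow_le_one₀ (norm_nonneg _) hlt.le
      rw [← Complex.normSq_eq_norm_sq, Complex.normSq_apply] at *
      rw [← Complex.normSq_eq_norm_sq, Complex.normSq_apply] at *
      simp only [Complex.sub_re, Complex.sub_im, Complex.mul_re, Complex.mul_im, Complex.conj_re,
        Complex.conj_im, Complex.one_re, Complex.one_im]
      nlinarith [mul_nonneg (sub_nonneg.2 ha) (sub_nonneg.2 hb)]
    have hBd : HasDerivAt B (deriv B 0) 0 :=
      (hB.differentiableAt (isOpen_unitDisk.mem_nhds h0)).hasDerivAt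
    have hS : (0 : ℝ) < 1 - ‖s‖ ^ 2 := by nlinarith [norm_nonneg s]
    have hSc : 1 - conj s * s ≠ 0 := hden 0 h0
    have hψ' : HasDerivAt ψ (deriv B 0 / (1 - conj s * s)) 0 := by
      have := (hBd.sub_const s).div ((hBd.const_mul (conj s)).const_sub 1) (hden 0 h0)
      convert! this using 1
      rw [← hs]
      field_simp
      ring
    have hge : 1 ≤ ‖deriv ψ 0‖ := by
      rw [hψ'.deriv, norm_div, hss]
      have : ‖(1 : ℂ) - ((‖s‖ ^ 2 : ℝ) : ℂ)‖ = 1 - ‖s‖ ^ 2 := by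
        rw [← Complex.ofReal_one, ← Complex.ofReal_sub, Complex.norm_real, Real.norm_eq_abs,
          abs_of_pos hS]
      rw [this, le_div_iff₀ hS, one_mul]
      exact hd
    have hle : ‖deriv ψ 0‖ ≤ 1 := by
      simpa using Complex.norm_deriv_le_div_of_mapsTo_ball hψd hψ1 one_pos
    have hnorm : ‖deriv ψ 0‖ = 1 := le_antisymm hle hge
    have haff := Complex.affine_of_mapsTo_ball_of_norm_dslope_eq_div hψd hψ1 h0
      (by simpa using hnorm)
    refine ⟨deriv ψ 0, hnorm, fun z hz => ?_⟩
    have h1 := haff hz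
    simp only [hψ0, sub_zero, smul_eq_mul, dslope_same, zero_add] at h1
    have h2 : B z - s = z * deriv ψ 0 * (1 - conj s * B z) := by
      rw [← h1]; simp only [hψ]; rw [div_mul_cancel₀ _ (hden z hz)]
    linear_combination h2
  · have hconst : ∀ z ∈ unitDisk, B z = s := by
      refine Complex.eqOn_of_isPreconnected_of_isMaxOn_norm
        (convex_ball (0 : ℂ) 1).isPreconnected isOpen_unitDisk hB h0 fun z hz => ?_
      simpa [heq] using hB1 z hz
    -- For |s| = 1 any unimodular u works, because s (1 + conj s · u z) = s + u z.
    refine ⟨1, norm_one, fun z hz => ?_⟩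
    rw [← hs] at heq
    rw [heq] at hss
    rw [hconst z hz]
    push_cast at hss
    linear_combination z * hss

/-! ### Radial poles of the logarithmic derivative -/

theorem HasDerivAt.half_log_norm_sq {h : ℝ → ℂ} {h' : ℂ} {r : ℝ} (hh : HasDerivAt h h' r)
    (h0 : h r ≠ 0) : HasDerivAt (fun r => Real.log (‖h r‖ ^ 2) / 2) (h' / h r).re r := by
  have := (hh.norm_sq.log (by positivity)).div_const 2
  convert! this using 1
  rw [Complex.inner, Complex.div_re, ← Complex.normSq_eq_norm_sq]
  simp only [Complex.mul_re, Complex.conj_re, Complex.conj_im]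
  have : Complex.normSq (h r) ≠ 0 := by simpa using h0
  field_simp
  ring

/-- A nonvanishing function on the disk whose logarithmic derivative has a boundary pole with
negative residue is unbounded. -/
theorem Complex.not_bounded_of_tendsto_logDeriv {F : ℂ → ℂ} (hF : DifferentiableOn ℂ F unitDisk)
    (hF0 : ∀ z ∈ unitDisk, F z ≠ 0) {η : ℂ} (hη : ‖η‖ = 1) {m : ℝ} (hm : 0 < m)
    (hlim : Tendsto (fun r : ℝ => (1 - r) * (η * (deriv F (r * η) / F (r * η))).re) (𝓝[<] 1)
      (𝓝 m)) (M : ℝ) : ∃ z ∈ unitDisk, M < ‖F z‖ := by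
  by_contra! hM
  have hmem : ∀ r : ℝ, 0 ≤ r → r < 1 → (r : ℂ) * η ∈ unitDisk := by
    intro r h0 h1
    rw [mem_unitDisk, norm_mul, hη, mul_one, Complex.norm_real, Real.norm_eq_abs,
      abs_of_nonneg h0]
    exact h1
  have hev := hlim.eventually (lt_mem_nhds (half_lt_self hm))
  obtain ⟨a, ha1, ha⟩ := (mem_nhdsLT_iff_exists_Ioo_subset' (zero_lt_one' ℝ)).1 hev
  have ha1 : a < 1 := ha1
  obtain ⟨b, hb, hb1⟩ := exists_between (max_lt ha1 (zero_lt_one' ℝ))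
  have hab : a < b := (le_max_left _ _).trans_lt hb
  have hb0 : 0 < b := (le_max_right _ _).trans_lt hb
  set h : ℝ → ℂ := fun r => F (r * η) with hh
  have hhd : ∀ r, b ≤ r → r < 1 → HasDerivAt h (deriv F (r * η) * η) r := by
    intro r hbr hr1
    have hl : HasDerivAt (fun r : ℝ => (r : ℂ) * η) η r := by
      simpa using (Complex.ofRealCLM.hasDerivAt (x := r)).mul_const η
    exact (hF.differentiableAt (isOpen_unitDisk.mem_nhds
      (hmem r (hb0.le.trans hbr) hr1))).hasDerivAt.comp r hl
  -- Near 1 the derivative of log|h| exceeds (m/2)/(1 - r), half the limiting rate, so L increases.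
  -- A bound on |h| would send L to -∞.
  set L : ℝ → ℝ := fun r => Real.log (‖h r‖ ^ 2) / 2 + m / 2 * Real.log (1 - r) with hL
  have hLd : ∀ r, b ≤ r → r < 1 → HasDerivAt L
      ((deriv F (r * η) * η / h r).re + m / 2 * (-1 / (1 - r))) r := by
    intro r hbr hr1
    refine ((hhd r hbr hr1).half_log_norm_sq (hF0 _ (hmem r (hb0.le.trans hbr) hr1))).add ?_
    exact (((hasDerivAt_id r).const_sub 1).log (sub_pos.2 hr1).ne').const_mul _
  have hmono : MonotoneOn L (Set.Ico b 1) := by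
    refine monotoneOn_of_deriv_nonneg (convex_Ico b 1)
      (fun r hr => (hLd r hr.1 hr.2).continuousAt.continuousWithinAt)
      (fun r hr => ?_) (fun r hr => ?_)
    · rw [interior_Ico] at hr
      exact (hLd r hr.1.le hr.2).differentiableAt.differentiableWithinAt
    · rw [interior_Ico] at hr
      rw [(hLd r hr.1.le hr.2).deriv]
      have h1 : m / 2 < (1 - r) * (η * (deriv F (r * η) / F (r * η))).re :=
        ha ⟨hab.trans hr.1, hr.2⟩
      have h2 : deriv F (r * η) * η / h r = η * (deriv F (r * η) / F (r * η)) := by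
        simp only [hh]; ring
      have h3 : 0 < 1 - r := sub_pos.2 hr.2
      rw [h2]
      have h4 : m / 2 / (1 - r) < (η * (deriv F (r * η) / F (r * η))).re := by
        rw [div_lt_iff₀ h3]; linarith
      have h5 : m / 2 * (-1 / (1 - r)) = -(m / 2 / (1 - r)) := by ring
      rw [h5]
      linarith
  have hbot : Tendsto (fun r : ℝ => Real.log (M ^ 2) / 2 + m / 2 * Real.log (1 - r)) (𝓝[<] 1)
      atBot := by
    refine tendsto_atBot_add_const_left _ _ (Tendsto.const_mul_atBot (half_pos hm) ?_)
    refine Real.tendsto_log_nhdsGT_zero.comp (tendsto_nhdsWithin_iff.2 ⟨?_, ?_⟩)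
    · have : Continuous fun r : ℝ => 1 - r := by fun_prop
      have h0 := this.tendsto 1
      rw [sub_self] at h0
      exact h0.mono_left nhdsWithin_le_nhds
    · filter_upwards [self_mem_nhdsWithin] with r hr using Set.mem_Ioi.2 (sub_pos.2 (Set.mem_Iio.1 hr))
  obtain ⟨r, hr, hrb⟩ := ((hbot.eventually (eventually_lt_atBot (L b))).and
    (Ioo_mem_nhdsLT hb1)).exists
  have hle := hmono ⟨le_rfl, hb1⟩ ⟨hrb.1.le, hrb.2⟩ hrb.1.le
  have hmr := hmem r (hb0.le.trans hrb.1.le) hrb.2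
  have hlog : Real.log (‖h r‖ ^ 2) ≤ Real.log (M ^ 2) := by
    have hpos : 0 < ‖h r‖ := norm_pos_iff.2 (hF0 _ hmr)
    exact Real.log_le_log (by positivity) (pow_le_pow_left₀ hpos.le (hM _ hmr) 2)
  simp only [hL] at hle hr
  linarith

section
variable {s u η : ℂ}

/-- The equation says η φ(η) = 1 for the disk automorphism φ(z) = (s + uz)/(1 + conj s · uz). Since
φ preserves the inside and the outside of the unit circle, η must lie on it. -/
theorem Complex.norm_eq_one_of_blaschke_root (hs : ‖s‖ < 1) (hu : ‖u‖ = 1)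
    (hη : η * (s + u * η) = 1 + conj s * (u * η)) : ‖η‖ = 1 := by
  have hx : ‖u * η‖ = ‖η‖ := by rw [norm_mul, hu, one_mul]
  set x := u * η
  have h1 : ‖η‖ ^ 2 * ‖s + x‖ ^ 2 = ‖1 + conj s * x‖ ^ 2 := by rw [← hη, norm_mul, mul_pow]
  have h2 : ‖s + x‖ ^ 2 - ‖1 + conj s * x‖ ^ 2 = -(1 - ‖s‖ ^ 2) * (1 - ‖x‖ ^ 2) := by
    simp only [← Complex.normSq_eq_norm_sq, Complex.normSq_apply, Complex.add_re, Complex.add_im,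
      Complex.mul_re, Complex.mul_im, Complex.conj_re, Complex.conj_im, Complex.one_re,
      Complex.one_im]
    ring
  rw [hx] at h2
  have h3 : (1 - ‖η‖ ^ 2) * (‖s + x‖ ^ 2 + (1 - ‖s‖ ^ 2)) = 0 := by linear_combination h2 - h1
  have h4 : 0 < ‖s + x‖ ^ 2 + (1 - ‖s‖ ^ 2) := by nlinarith [norm_nonneg s, sq_nonneg ‖s + x‖]
  have h5 : 1 - ‖η‖ ^ 2 = 0 := (mul_eq_zero.1 h3).resolve_right h4.ne'
  nlinarith [norm_nonneg η]

/-- The roots of the quadratic have product -1/u, so 1 + uη² = 0 would mean a double root. It would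
force Re(sη) = 1, against |s| < 1. -/
theorem Complex.one_add_mul_sq_ne_zero_of_blaschke_root (hs : ‖s‖ < 1) (hη1 : ‖η‖ = 1)
    (hη : η * (s + u * η) = 1 + conj s * (u * η)) : 1 + u * η ^ 2 ≠ 0 := by
  intro h
  have hηη : conj η * η = 1 := by
    rw [mul_comm, Complex.mul_conj, Complex.normSq_eq_norm_sq, hη1]; norm_num
  have h1 : s * η + conj (s * η) = 2 := by
    rw [map_mul]
    linear_combination hη + (1 - conj s * conj η) * (-h) + (conj s * u * η) * (-hηη)
  have h2 := congrArg Complex.re h1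
  rw [Complex.add_re, Complex.conj_re] at h2
  have h3 := Complex.re_le_norm (s * η)
  rw [norm_mul, hη1, mul_one] at h3
  have h4 : (2 : ℂ).re = 2 := rfl
  linarith

theorem Complex.exists_blaschke_root_ne (hs : ‖s‖ < 1) (hu : ‖u‖ = 1) (ζ : ℂ) :
    ∃ η : ℂ, η ≠ ζ ∧ ‖η‖ = 1 ∧ η * (s + u * η) = 1 + conj s * (u * η) := by
  have hu0 : u ≠ 0 := by rintro rfl; simp at hu
  have huu : conj u * u = 1 := by
    rw [mul_comm, Complex.mul_conj, Complex.normSq_eq_norm_sq, hu]; norm_num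
  obtain ⟨d, hd⟩ := IsAlgClosed.exists_pow_nat_eq (discrim u (s - conj s * u) (-1)) two_pos
  obtain ⟨η, hη⟩ := exists_quadratic_eq_zero hu0 ⟨d, by rw [← hd, sq]⟩
  have hroot : η * (s + u * η) = 1 + conj s * (u * η) := by linear_combination hη
  have h1 := Complex.norm_eq_one_of_blaschke_root hs hu hroot
  have hηη : conj η * η = 1 := by
    rw [mul_comm, Complex.mul_conj, Complex.normSq_eq_norm_sq, h1]; norm_num
  by_cases hne : η = ζ
  -- The second root is -1/(uη), which is -conj(uη) on the unit circle.
  · have hroot' : (-(conj u * conj η)) * (s + u * (-(conj u * conj η))) =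
        1 + conj s * (u * (-(conj u * conj η))) := by
      linear_combination (-conj u * conj η ^ 2) * hroot +
        (conj u * conj η * s - conj s * u * conj u * conj η + u * conj u * (η * conj η + 1)) * hηη +
        (conj u * conj η ^ 2 + 1) * huu
    refine ⟨-(conj u * conj η), fun h => ?_, ?_, hroot'⟩
    · refine Complex.one_add_mul_sq_ne_zero_of_blaschke_root hs h1 hroot ?_
      rw [← hne] at h
      linear_combination (-u * η) * h - hηη - (conj η * η) * huu
    · rw [norm_neg, norm_mul, RCLike.norm_conj, RCLike.norm_conj, hu, h1, one_mul]
  · exact ⟨η, hne, h1, hroot⟩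

/-- A function of the form `q z / (1 - conj η z)` has a simple radial pole at `η`. -/
theorem Complex.tendsto_radial_pole {T q : ℂ → ℂ} (hη : ‖η‖ = 1) (hq : ContinuousAt q η)
    (hT : ∀ z ∈ unitDisk, T z * (1 - conj η * z) = q z) :
    Tendsto (fun r : ℝ => (1 - r) * (η * T (r * η)).re) (𝓝[<] 1) (𝓝 (η * q η).re) := by
  have hηη : conj η * η = 1 := by
    rw [mul_comm, Complex.mul_conj, Complex.normSq_eq_norm_sq, hη]; norm_num
  have hpath : Tendsto (fun r : ℝ => (r : ℂ) * η) (𝓝[<] 1) (𝓝 η) := by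
    have : Continuous fun r : ℝ => (r : ℂ) * η := by fun_prop
    have h1 := this.tendsto 1
    simp only [Complex.ofReal_one, one_mul] at h1
    exact h1.mono_left nhdsWithin_le_nhds
  have hlim := (Complex.continuous_re.tendsto _).comp
    ((hq.tendsto.comp hpath).const_mul η)
  refine hlim.congr' ?_
  filter_upwards [Ioo_mem_nhdsLT (zero_lt_one' ℝ)] with r hr
  have hmem : (r : ℂ) * η ∈ unitDisk := by
    rw [mem_unitDisk, norm_mul, hη, mul_one, Complex.norm_real, Real.norm_eq_abs,
      abs_of_pos hr.1]
    exact hr.2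
  have h1 := hT _ hmem
  have h2 : q (r * η) = ((1 - r : ℝ) : ℂ) * T (r * η) := by
    rw [← h1]; push_cast; linear_combination (-T (r * η) * r) * hηη
  simp only [Function.comp_apply]
  rw [h2, ← Complex.re_ofReal_mul]
  congr 1
  ring

/-- Solving for T gives the denominator 1 + conj s · uz - z(s + uz). For |s| < 1 it has two distinct
unimodular roots, so one avoids ζ. For |s| = 1 the relation collapses to T = s/(1 - sz), and sζ ≠ 1
keeps its pole away from ζ. -/
theorem Complex.exists_radial_pole {T : ℂ → ℂ} {ζ : ℂ} (hs : ‖s‖ ≤ 1) (hu : ‖u‖ = 1)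
    (hsζ : s * ζ ≠ 1)
    (hT : ∀ z ∈ unitDisk, T z * (1 + conj s * u * z) = (1 + z * T z) * (s + u * z)) :
    ∃ η : ℂ, ‖η‖ = 1 ∧ η ≠ ζ ∧ ∃ m : ℝ, 0 < m ∧
      Tendsto (fun r : ℝ => (1 - r) * (η * T (r * η)).re) (𝓝[<] 1) (𝓝 m) := by
  rcases hs.lt_or_eq with hs | hs
  · obtain ⟨η, hne, hη, hroot⟩ := Complex.exists_blaschke_root_ne hs hu ζ
    have hηη : conj η * η = 1 := by
      rw [mul_comm, Complex.mul_conj, Complex.normSq_eq_norm_sq, hη]; norm_num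
    have hv := Complex.one_add_mul_sq_ne_zero_of_blaschke_root hs hη hroot
    refine ⟨η, hη, hne, (1 - ‖s * η‖ ^ 2) / (2 - 2 * (s * η).re), ?_, ?_⟩
    · have h1 := Complex.re_le_norm (s * η)
      have h2 : ‖s * η‖ = ‖s‖ := by rw [norm_mul, hη, mul_one]
      rw [h2] at h1 ⊢
      exact div_pos (by nlinarith [norm_nonneg s]) (by linarith)
    -- Matching linear coefficients factors the denominator as (1 - conj η · z)(1 + uηz). The value
    -- m is η q(η), which turns out to be real.
    · have hfac : conj s * u - s = u * η - conj η := by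
        linear_combination (conj s * u - s - u * η) * (-hηη) - conj η * hroot
      convert Complex.tendsto_radial_pole (q := fun z => (s + u * z) / (1 + u * η * z)) hη ?_ ?_
        using 2
      · have hx : s * η * conj (s * η) = (‖s * η‖ ^ 2 : ℝ) := by
          rw [Complex.mul_conj, Complex.normSq_eq_norm_sq]
        have hx2 : s * η + conj (s * η) = (2 * (s * η).re : ℝ) := Complex.add_conj _
        have hden : (2 : ℝ) - 2 * (s * η).re ≠ 0 := by
          have h1 := Complex.re_le_norm (s * η)
          rw [norm_mul, hη, mul_one] at h1
          linarith
        have : η * ((s + u * η) / (1 + u * η * η)) =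
            (((1 - ‖s * η‖ ^ 2) / (2 - 2 * (s * η).re) : ℝ) : ℂ) := by
          rw [Complex.ofReal_div, Complex.ofReal_sub, Complex.ofReal_sub, ← hx, ← hx2, ← mul_div_assoc,
            div_eq_div_iff]
          · rw [map_mul, Complex.ofReal_one, Complex.ofReal_ofNat]
            linear_combination (1 - s * η) * hroot - (1 - s * η) * conj s * u * η * hηη
          · rwa [mul_assoc, ← sq]
          · rw [hx2]; exact_mod_cast hden
        rw [this, Complex.ofReal_re]
      · refine ContinuousAt.div (by fun_prop) (by fun_prop) ?_
        rwa [mul_assoc, ← sq]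
      · intro z hz
        have h1 : 1 + u * η * z ≠ 0 := by
          intro h
          have : ‖u * η * z‖ = 1 := by
            rw [← norm_one (α := ℂ), ← norm_neg (1 : ℂ)]; congr 1; linear_combination h
          rw [norm_mul, norm_mul, hu, hη, one_mul, one_mul] at this
          exact (mem_unitDisk.1 hz).ne this
        rw [eq_div_iff h1]
        linear_combination hT z hz - z * T z * hfac - u * z ^ 2 * T z * hηη
  · have hss : conj s * s = 1 := by
      rw [mul_comm, Complex.mul_conj, Complex.normSq_eq_norm_sq, hs]; norm_num
    have hη : ‖conj s‖ = 1 := by rw [RCLike.norm_conj, hs]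
    refine ⟨conj s, hη, ?_, 1, one_pos, ?_⟩
    · rintro rfl
      exact hsζ (by rw [mul_comm]; exact hss)
    · convert Complex.tendsto_radial_pole (q := fun _ => s) hη continuousAt_const ?_ using 2
      · rw [hss, Complex.one_re]
      · intro z hz
        have h1 : 1 + conj s * u * z ≠ 0 := by
          intro h
          have : ‖conj s * u * z‖ = 1 := by
            rw [← norm_one (α := ℂ), ← norm_neg (1 : ℂ)]; congr 1; linear_combination h
          rw [norm_mul, norm_mul, hu, hη, one_mul, one_mul] at this
          exact (mem_unitDisk.1 hz).ne this
        rw [Complex.conj_conj]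
        refine mul_right_cancel₀ h1 ?_
        linear_combination hT z hz - (1 + z * T z) * u * z * hss

end

/-! ### The strict inequality at a boundary point -/

/-- A boundary point `w` whose limiting two-point function has nonnegative real part satisfies
`Re (a₂ w) > -1/2` strictly, because `f` is bounded. -/
theorem IsNormalizedConformalMap.one_add_two_mul_re_pos {f : ℂ → ℂ} {Ω : Set ℂ}
    (hf : IsNormalizedConformalMap f Ω) (hbdd : Bornology.IsBounded Ω) {w ζ : ℂ}
    (hw : w ∉ Ω) (hζ : ‖ζ‖ = 1)
    (hp : ∀ z ∈ unitDisk, 0 ≤ (2 * z * deriv f z / (f z - w) - (z + ζ) / (z - ζ)).re) :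
    0 < 1 + 2 * (secondCoeff f * w).re := by
  by_contra! hneg
  have h0 : (0 : ℂ) ∈ unitDisk := by simp [mem_unitDisk]
  have hζ0 : ζ ≠ 0 := by rintro rfl; simp at hζ
  have hfw : ∀ z ∈ unitDisk, f z - w ≠ 0 := fun z hz h =>
    hw (by rw [← sub_eq_zero.1 h, ← hf.image_eq]; exact Set.mem_image_of_mem f hz)
  have hzζ : ∀ z ∈ unitDisk, z - ζ ≠ 0 := fun z hz h => by
    rw [mem_unitDisk, sub_eq_zero.1 h, hζ] at hz
    exact lt_irrefl _ hz
  have hw0 : w ≠ 0 := by simpa [hf.map_zero] using hfw 0 h0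
  have hf'd : DifferentiableOn ℂ (deriv f) unitDisk := hf.differentiableOn.deriv isOpen_unitDisk
  set T : ℂ → ℂ := fun z => deriv f z / (f z - w) - 1 / (z - ζ) with hTdef
  have hTd : DifferentiableOn ℂ T unitDisk :=
    (hf'd.div (hf.differentiableOn.sub_const w) hfw).sub
      ((differentiableOn_const _).div (by fun_prop) hzζ)
  have hTre : ∀ z ∈ unitDisk, -1 ≤ 2 * (z * T z).re := by
    intro z hz
    have h1 := hp z hz
    have h2 : 2 * z * deriv f z / (f z - w) - (z + ζ) / (z - ζ) = ((2 : ℝ) : ℂ) * (z * T z) + 1 := by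
      have := hfw z hz
      have := hzζ z hz
      simp only [hTdef]
      push_cast
      field_simp
      ring
    rw [h2, Complex.add_re, Complex.re_ofReal_mul, Complex.one_re] at h1
    linarith
  have hden : ∀ z ∈ unitDisk, 1 + z * T z ≠ 0 := by
    intro z hz h
    have h1 := congrArg Complex.re h
    rw [Complex.add_re, Complex.one_re, Complex.zero_re] at h1
    linarith [hTre z hz]
  set B : ℂ → ℂ := fun z => T z / (1 + z * T z) with hBdef
  have hBd : DifferentiableOn ℂ B unitDisk := hTd.div (by fun_prop) hden
  have hzB : ∀ z ∈ unitDisk, ‖z * B z‖ ≤ 1 := by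
    intro z hz
    simp only [hBdef]
    rw [← mul_div_assoc, norm_div]
    refine div_le_one_of_le₀ ((sq_le_sq₀ (norm_nonneg _) (norm_nonneg _)).1 ?_) (norm_nonneg _)
    rw [← Complex.normSq_eq_norm_sq, ← Complex.normSq_eq_norm_sq, Complex.normSq_apply,
      Complex.normSq_apply, Complex.add_re, Complex.add_im, Complex.one_re, Complex.one_im]
    linarith [hTre z hz]
  -- The Schwarz lemma removes the factor z from |zB| ≤ 1.
  have hB1 : ∀ z ∈ unitDisk, ‖B z‖ ≤ 1 := by
    intro z hz
    have h1 : DifferentiableOn ℂ (fun z => z * B z) unitDisk := by fun_prop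
    have h2 := Complex.norm_dslope_le_div_of_mapsTo_ball (R₂ := 1) h1 (fun x hx => by
      simpa using hzB x hx) hz
    have h3 : dslope (fun z => z * B z) 0 z = B z := by
      rcases eq_or_ne z 0 with rfl | hz0
      · rw [dslope_same]
        have := (hasDerivAt_id (0 : ℂ)).mul
          (hBd.differentiableAt (isOpen_unitDisk.mem_nhds h0)).hasDerivAt
        simpa using! this.deriv
      · rw [dslope_of_ne _ hz0, slope_def_field]
        field_simp
        simp [mul_comm]
    rwa [h3, div_one] at h2
  set a := secondCoeff f with ha
  have hf0 : HasDerivAt f 1 0 := by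
    rw [← hf.deriv_zero]
    exact (hf.differentiableOn.differentiableAt (isOpen_unitDisk.mem_nhds h0)).hasDerivAt
  have hf'0 : HasDerivAt (deriv f) (2 * a) 0 := by
    have h1 : 2 * a = deriv (deriv f) 0 := by
      rw [ha, secondCoeff, iteratedDeriv_succ, iteratedDeriv_one]; ring
    rw [h1]
    exact (hf'd.differentiableAt (isOpen_unitDisk.mem_nhds h0)).hasDerivAt
  have hT0 : T 0 = 1 / ζ - 1 / w := by
    simp only [hTdef, hf.deriv_zero, hf.map_zero]
    field_simp
    ring
  have hB0 : B 0 = 1 / ζ - 1 / w := by simp [hBdef, hT0]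
  have hT' : HasDerivAt T (-2 * a / w - 1 / w ^ 2 + 1 / ζ ^ 2) 0 := by
    have h1 := (hf'0.div (hf0.sub_const w) (hfw 0 h0)).sub
      ((hasDerivAt_const (0 : ℂ) (1 : ℂ)).div ((hasDerivAt_id (0 : ℂ)).sub_const ζ) (hzζ 0 h0))
    convert! h1 using 1
    simp only [hf.deriv_zero, hf.map_zero, id]
    field_simp
    ring
  have hB' : HasDerivAt B (2 / w * (1 / ζ - 1 / w - a)) 0 := by
    have h1 := hT'.div (((hasDerivAt_id (0 : ℂ)).mul hT').const_add 1) (hden 0 h0)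
    convert! h1 using 1
    simp only [hT0, id, Pi.mul_apply]
    field_simp
    ring
  -- With W = 1/w and s = 1/ζ - W, the relation |W + s| = 1 gives Re(conj W · 2(s - a)) = 1 - |s|² -
  -- |W|² (1 + 2 Re(aw)). The negated claim makes the last term help.
  have hext : 1 - ‖B 0‖ ^ 2 ≤ ‖deriv B 0‖ := by
    rw [hB'.deriv, hB0]
    set W := 1 / w with hW
    set s := 1 / ζ - W with hs
    have h1 : ‖2 / w * (s - a)‖ = ‖conj W * (2 * (s - a))‖ := by
      rw [norm_mul (conj W), RCLike.norm_conj, ← norm_mul, hW]; congr 1; ring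
    have h2 := Complex.re_le_norm (conj W * (2 * (s - a)))
    have h3 : ‖W + s‖ ^ 2 = 1 := by
      rw [hs, add_sub_cancel, norm_div, hζ]; norm_num
    have hWw : a = (a * w) * W := by rw [hW]; field_simp
    have h4 : conj W * a = ((‖W‖ ^ 2 : ℝ) : ℂ) * (a * w) := by
      rw [← Complex.normSq_eq_norm_sq, ← Complex.mul_conj]
      linear_combination conj W * hWw
    have h5 : (conj W * a).re = ‖W‖ ^ 2 * (a * w).re := by rw [h4, Complex.re_ofReal_mul]
    have h6 : ‖W + s‖ ^ 2 = ‖W‖ ^ 2 + ‖s‖ ^ 2 + 2 * (conj W * s).re := by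
      simp only [← Complex.normSq_eq_norm_sq, Complex.normSq_apply, Complex.add_re,
        Complex.add_im, Complex.mul_re, Complex.conj_re, Complex.conj_im]
      ring
    have h7 : (conj W * (2 * (s - a))).re = 2 * (conj W * s).re - 2 * (conj W * a).re := by
      have : conj W * (2 * (s - a)) = ((2 : ℝ) : ℂ) * (conj W * s - conj W * a) := by
        push_cast; ring
      rw [this, Complex.re_ofReal_mul, Complex.sub_re]; ring
    rw [h1]
    nlinarith [mul_nonneg (sq_nonneg ‖W‖) (sub_nonneg.2 hneg)]
  obtain ⟨u, hu, hform⟩ := Complex.schwarzPick_eq hBd hB1 hext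
  obtain ⟨η, hη, hne, m, hm, hlim⟩ := Complex.exists_radial_pole (T := T) (ζ := ζ) (hB1 0 h0) hu
    (by
      rw [hB0]
      intro h
      have : ζ / w = 0 := by
        field_simp at h ⊢
        linear_combination -h
      exact div_ne_zero hζ0 hw0 this)
    (fun z hz => by
      have h1 := hform z hz
      have h2 : B z * (1 + z * T z) = T z := div_mul_cancel₀ _ (hden z hz)
      linear_combination (1 + z * T z) * h1 - (1 + conj (B 0) * u * z) * h2)
  -- Since η ≠ ζ, the term 1/(z - ζ) separating T from f'/(f - w) is regular at η and does not alter
  -- the limit m.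
  have hregular : Tendsto (fun r : ℝ => (1 - r) * (η * (1 / (r * η - ζ))).re) (𝓝[<] 1) (𝓝 0) := by
    have hc : ContinuousAt (fun r : ℝ => (1 - r) * (η * (1 / ((r : ℂ) * η - ζ))).re) 1 := by
      refine ContinuousAt.mul (by fun_prop) (Complex.continuous_re.continuousAt.comp ?_)
      refine continuousAt_const.mul (continuousAt_const.div (by fun_prop) ?_)
      simpa [sub_eq_zero] using hne
    have := hc.tendsto
    simp only [sub_self, zero_mul] at this
    exact this.mono_left nhdsWithin_le_nhds
  obtain ⟨M, hM⟩ := hbdd.exists_norm_le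
  obtain ⟨z, hz, hlt⟩ := Complex.not_bounded_of_tendsto_logDeriv
    (hf.differentiableOn.sub_const w) hfw hη hm (by
      have := hlim.add hregular
      rw [add_zero] at this
      refine this.congr fun r => ?_
      rw [← mul_add, ← Complex.add_re, ← mul_add]
      simp only [hTdef, sub_add_cancel, deriv_sub_const]) (M + ‖w‖)
  have h1 := norm_sub_le (f z) w
  have h2 := hM (f z) (hf.image_eq ▸ Set.mem_image_of_mem f hz)
  linarith

/-! ### Passage to the boundary and conclusion -/

/-- Preimages of points tending to w subconverge to some ζ. It cannot lie in the open disk, as then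
w = f(ζ) ∈ Ω. No boundary extension of f is needed. -/
theorem IsNormalizedConformalMap.two_point_of_mem_closure {f : ℂ → ℂ} {Ω : Set ℂ}
    (hf : IsNormalizedConformalMap f Ω) (hconv : Convex ℝ Ω) {w : ℂ} (hw : w ∉ Ω)
    (hwc : w ∈ closure Ω) :
    ∃ ζ : ℂ, ‖ζ‖ = 1 ∧
      ∀ z ∈ unitDisk, 0 ≤ (2 * z * deriv f z / (f z - w) - (z + ζ) / (z - ζ)).re := by
  obtain ⟨y, hyΩ, hyw⟩ := mem_closure_iff_seq_limit.1 hwc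
  have hpre : ∀ n, ∃ x ∈ unitDisk, f x = y n := fun n => by
    have := hyΩ n
    rwa [← hf.image_eq] at this
  choose x hxD hxy using hpre
  obtain ⟨ζ, hζ, φ, hφ, hlim⟩ := (isCompact_closedBall (0 : ℂ) 1).tendsto_subseq
    (fun n => Metric.ball_subset_closedBall (hxD n))
  rw [mem_closedBall_zero_iff] at hζ
  have hylim : Tendsto (fun n => f (x (φ n))) atTop (𝓝 w) := by
    simpa only [hxy] using! hyw.comp hφ.tendsto_atTop
  have hζ1 : ‖ζ‖ = 1 := by
    refine hζ.eq_of_not_lt fun hlt => hw ?_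
    have hζD : ζ ∈ unitDisk := mem_unitDisk.2 hlt
    have hc := (hf.differentiableOn.differentiableAt
      (isOpen_unitDisk.mem_nhds hζD)).continuousAt.tendsto.comp hlim
    rw [tendsto_nhds_unique hylim hc, ← hf.image_eq]
    exact Set.mem_image_of_mem f hζD
  refine ⟨ζ, hζ1, fun z hz => ?_⟩
  have hfz : f z - w ≠ 0 := fun h =>
    hw (by rw [← sub_eq_zero.1 h, ← hf.image_eq]; exact Set.mem_image_of_mem f hz)
  have hzζ : z - ζ ≠ 0 := fun h => by
    rw [mem_unitDisk, sub_eq_zero.1 h, hζ1] at hz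
    exact lt_irrefl _ hz
  have hlim' : Tendsto (fun n => x (φ n)) atTop (𝓝 ζ) := hlim
  have htend := (Complex.continuous_re.tendsto _).comp
    (((tendsto_const_nhds (x := 2 * z * deriv f z)).div (hylim.const_sub (f z)) hfz).sub
      ((hlim'.const_add z).div (hlim'.const_sub z) hzζ))
  refine ge_of_tendsto htend ?_
  have hnorm : ∀ᶠ n in atTop, ‖z‖ < ‖x (φ n)‖ :=
    hlim'.norm.eventually (lt_mem_nhds (by rw [hζ1]; exact mem_unitDisk.1 hz))
  filter_upwards [hnorm] with n hn using hf.two_point hconv (hxD _) hn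

theorem IsNormalizedConformalMap.exists_pos_le_one_add_two_mul_re {f : ℂ → ℂ} {Ω : Set ℂ}
    (hf : IsNormalizedConformalMap f Ω) (hconv : Convex ℝ Ω) (hbdd : Bornology.IsBounded Ω) :
    ∃ δ : ℝ, 0 < δ ∧ ∀ z ∈ unitDisk, δ ≤ 1 + 2 * (secondCoeff f * f z).re := by
  set a := secondCoeff f with ha
  rcases eq_or_ne a 0 with ha0 | ha0
  · exact ⟨1, one_pos, fun z _ => by simp [ha0]⟩
  have hmem : ∀ z ∈ unitDisk, f z ∈ Ω := fun z hz => hf.image_eq ▸ Set.mem_image_of_mem f hz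
  have hopen : IsOpen Ω := hf.image_eq ▸
    hf.injOn.isOpen_image_of_differentiableOn hf.differentiableOn isOpen_unitDisk subset_rfl
      isOpen_unitDisk
  have hne : (closure Ω).Nonempty := ⟨f 0, subset_closure (hmem 0 (by simp [mem_unitDisk]))⟩
  obtain ⟨w, hwc, hmin⟩ := hbdd.isCompact_closure.exists_isMinOn hne
    (f := fun v => (a * v).re) (by fun_prop)
  -- In the open set Ω a small move in the direction -conj a would lower Re(a w).
  have hw : w ∉ Ω := by
    intro hwΩ
    have hpath : Tendsto (fun t : ℝ => w - t * conj a) (𝓝[>] 0) (𝓝 w) := by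
      have : Continuous fun t : ℝ => w - t * conj a := by fun_prop
      have h0 := this.tendsto 0
      simp only [Complex.ofReal_zero, zero_mul, sub_zero] at h0
      exact h0.mono_left nhdsWithin_le_nhds
    obtain ⟨t, htΩ, ht⟩ :=
      ((hpath.eventually (hopen.eventually_mem hwΩ)).and self_mem_nhdsWithin).exists
    have h1 : (a * w).re ≤ (a * (w - t * conj a)).re := hmin (subset_closure htΩ)
    have h2 : a * (w - t * conj a) = a * w - ((t * Complex.normSq a : ℝ) : ℂ) := by
      push_cast; rw [← Complex.mul_conj]; ring
    rw [h2, Complex.sub_re, Complex.ofReal_re] at h1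
    have h3 : 0 < t * Complex.normSq a := mul_pos ht (Complex.normSq_pos.2 ha0)
    linarith
  obtain ⟨ζ, hζ, hp⟩ := hf.two_point_of_mem_closure hconv hw hwc
  refine ⟨_, hf.one_add_two_mul_re_pos hbdd hw hζ hp, fun z hz => ?_⟩
  have h1 : (a * w).re ≤ (a * f z).re := hmin (subset_closure (hmem z hz))
  linarith

/-- Besides the bound, the conclusion records that the denominator of `f*` has no zero in the
disk, so that `f*` is a genuine finite-valued function there. -/
theorem theorem2p4 (f : ℂ → ℂ) (Ω : Set ℂ)
    (hf : IsNormalizedConformalMap f Ω)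
    (hconv : Convex ℝ Ω) (hbdd : Bornology.IsBounded Ω) :
    (∀ z ∈ unitDisk, 1 + secondCoeff f * f z ≠ 0) ∧
      ∃ c : ℝ, c < 1 ∧
        ∀ z ∈ unitDisk, ‖secondCoeff f * moebiusNormalization f z‖ ≤ c := by
  obtain ⟨δ, hδ, hre⟩ := hf.exists_pos_le_one_add_two_mul_re hconv hbdd
  set a := secondCoeff f with ha
  have hnorm : ∀ z, ‖1 + a * f z‖ ^ 2 = ‖a * f z‖ ^ 2 + (1 + 2 * (a * f z).re) := by
    intro z
    rw [← Complex.normSq_eq_norm_sq, ← Complex.normSq_eq_norm_sq, Complex.normSq_add, map_one,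
      one_mul, Complex.conj_re]
    ring
  have hne : ∀ z ∈ unitDisk, 1 + a * f z ≠ 0 := by
    intro z hz h
    have h1 := hnorm z
    rw [h, norm_zero] at h1
    nlinarith [hre z hz, sq_nonneg ‖a * f z‖]
  obtain ⟨M, hM⟩ := hbdd.exists_norm_le
  set R := ‖a‖ * M with hR
  have hRz : ∀ z ∈ unitDisk, ‖a * f z‖ ^ 2 ≤ R ^ 2 := by
    intro z hz
    refine pow_le_pow_left₀ (norm_nonneg _) ?_ 2
    rw [norm_mul]
    exact mul_le_mul_of_nonneg_left (hM _ (hf.image_eq ▸ Set.mem_image_of_mem f hz))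
      (norm_nonneg _)
  have hpos : 0 < R ^ 2 + δ := by positivity
  -- The squared modulus is t/(t + x) with t = |a f|² ≤ R² and x = 1 + 2 Re(a f) ≥ δ; it increases
  -- in t and decreases in x.
  refine ⟨hne, Real.sqrt (R ^ 2 / (R ^ 2 + δ)), ?_, fun z hz => ?_⟩
  · rw [Real.sqrt_lt' one_pos, one_pow, div_lt_one hpos]
    linarith
  · refine Real.le_sqrt_of_sq_le ?_
    rw [moebiusNormalization, ← mul_div_assoc, norm_div, div_pow, hnorm z,
      div_le_div_iff₀ (by nlinarith [hre z hz, sq_nonneg ‖a * f z‖]) hpos]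
    nlinarith [hre z hz, hRz z hz, sq_nonneg R, sq_nonneg ‖a * f z‖,
      mul_le_mul_of_nonneg_right (hRz z hz) hδ.le,
      mul_le_mul_of_nonneg_left (hre z hz) (sq_nonneg R)]
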